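/- Let $\mathcal C$ be a triangulated category and let $\mathcal D=(\mathcal D^{\le 0},\mathcal D^{\ge 0})$ and $\mathcal T=(\mathcal T^{\le 0},\mathcal T^{\ge 0})$ be $t$-structures on $\mathcal C$, with $\mathcal D^{\le m}=\mathcal D^{\le 0}[-m]$, $\mathcal D^{\ge m}=\mathcal D^{\ge 0}[-m]$ (and likewise for $\mathcal T$), hearts $\mathcal H_{\mathcal D}=\mathcal D^{\le 0}\cap\mathcal D^{\ge 0}$ and $\mathcal H_{\mathcal T}=\mathcal T^{\le 0}\cap\mathcal T^{\ge 0}$, and truncation functors $\delta^{\le m},\delta^{\ge m}$ of $\mathcal D$. The pair $(\mathcal D,\mathcal T)$ is *filterable* if either $\mathcal D^{\ge i}\cap\mathcal T^{\ge 0}$ is the co-aisle of a $t$-structure for every $i\in\mathbb Z$, or $\mathcal D^{\le i}\cap\mathcal T^{\le 0}$ is the aisle of a $t$-structure for every $i\in\mathbb Z$. It is *of type* $(n,k)$, with $n\in\mathbb N$ and $k\in\mathbb Z$, if $k$ is the largest integer with $\mathcal T^{\le k}\subseteq\mathcal D^{\le 0}$ and $n$ is the smallest natural number with $\mathcal D^{\le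 -n}\subseteq\mathcal T^{\le k}$. It is *$n$-tilting* (resp. *$n$-cotilting*) if it is filterable of type $(n,0)$ and every object of $\mathcal H_{\mathcal D}$ embeds in $\mathcal H_{\mathcal D}$ into an object of $\mathcal H_{\mathcal D}\cap\mathcal H_{\mathcal T}$ (resp. is a quotient in $\mathcal H_{\mathcal D}$ of an object of $\mathcal H_{\mathcal D}\cap\mathcal H_{\mathcal T}[-n]$). The $t$-structure $\mathcal T$ is *left* (resp. *right*) *$\mathcal D$-compatible* if $\delta^{\le m}(\mathcal T^{\le 0})\subseteq\mathcal T^{\le 0}$ (resp. $\delta^{\ge m}(\mathcal T^{\ge 0})\subseteq\mathcal T^{\ge 0}$) for all $m\in\mathbb Z$. 1. If $(\mathcal D,\mathcal T)$ is $n$-tilting, then $\mathcal T$ is left $\mathcal D$-compatible if and only if $n=0$ or $n=1$. 2. If $(\mathcal D,\mathcal T)$ is $n$-cotilting, then $\mathcal T$ is right $\mathcal D$-compatible if and only if $n=0$ or $n=1$; moreover, if $n=0$ or $n=1$, then $\mathcal T$ is also left $\mathcal D$-compatible. -/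

import Mathlib

open CategoryTheory CategoryTheory.Limits CategoryTheory.Triangulated

universe v u

namespace TStructurePair

section Generation

variable {A : Type u} [Category.{v} A]

/-- The full subcategory `S` cogenerates `A`: every object of `A` embeds in an object of `S`. -/
def Cogenerates (S : ObjectProperty A) : Prop :=
  ∀ M : A, ∃ X : A, S X ∧ ∃ i : M ⟶ X, Mono i

/-- The full subcategory `S` generates `A`: every object of `A` is a quotient of an object
of `S`. -/
def Generates (S : ObjectProperty A) : Prop :=
  ∀ M : A, ∃ X : A, S X ∧ ∃ p : X ⟶ M, Epi p

end Generation

variable {C : Type u} [Category.{v} C] [Preadditive C] [HasZeroObject C] [HasShift C ℤ]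
  [∀ n : ℤ, (shiftFunctor C n).Additive] [Pretriangulated C]

/-- The pair `(D, T)` has shift `k` and gap `n`: `k` is the greatest integer such that
`T^{≤ k} ⊆ D^{≤ 0}` and `n` is the least natural number such that `D^{≤ -n} ⊆ T^{≤ k}`. -/
structure IsOfType (D T : TStructure C) (n : ℕ) (k : ℤ) : Prop where
  shift : IsGreatest {j : ℤ | T.le j ≤ D.le 0} k
  gap : IsLeast {m : ℕ | D.le (-(m : ℤ)) ≤ T.le k} n

/-- For every `i`, the intersection `D^{≥ i} ∩ T^{≥ 0}` is the co-aisle of a t-structure. -/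
def IsRightFilterable (D T : TStructure C) : Prop :=
  ∀ i : ℤ, ∃ E : TStructure C, E.ge 0 = D.ge i ⊓ T.ge 0

/-- For every `i`, the intersection `D^{≤ i} ∩ T^{≤ 0}` is the aisle of a t-structure. -/
def IsLeftFilterable (D T : TStructure C) : Prop :=
  ∀ i : ℤ, ∃ E : TStructure C, E.le 0 = D.le i ⊓ T.le 0

/-- A pair is filterable if it is right or left filterable. -/
def IsFilterable (D T : TStructure C) : Prop :=
  IsRightFilterable D T ∨ IsLeftFilterable D T

/-- The pair `(D, T)` is `n`-tilting: it is filterable of type `(n, 0)` and `H_D ∩ H_T`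
cogenerates the heart `H_D`. -/
structure IsTilting (D T : TStructure C) (n : ℕ) : Prop where
  filterable : IsFilterable D T
  ofType : IsOfType D T n 0
  cogenerates : Cogenerates (T.heart.inverseImage D.heart.ι)

/-- The pair `(D, T)` is `n`-cotilting: it is filterable of type `(n, 0)` and `H_D ∩ H_T[-n]`
generates the heart `H_D`; here `X` lies in `H_T[-n]` when `X[n]` lies in `H_T`. -/
structure IsCotilting (D T : TStructure C) (n : ℕ) : Prop where
  filterable : IsFilterable D T
  ofType : IsOfType D T n 0
  generates : Generates ((T.heart.shift (n : ℤ)).inverseImage D.heart.ι)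

/-- `T` is left `D`-compatible: `T^{≤ 0}` is stable under all truncation functors
`δ^{≤ m}` of `D`. -/
def IsLeftCompatible (D T : TStructure C) : Prop :=
  ∀ (m : ℤ) (X : C), T.le 0 X → T.le 0 ((D.truncLE m).obj X)

/-- `T` is right `D`-compatible: `T^{≥ 0}` is stable under all truncation functors
`δ^{≥ m}` of `D`. -/
def IsRightCompatible (D T : TStructure C) : Prop :=
  ∀ (m : ℤ) (X : C), T.ge 0 X → T.ge 0 ((D.truncGE m).obj X)

end TStructurePair

/-!
Let `f` be a morphism of the heart of `D`. The `D`-truncation triangle of its cone `W` is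
`(ker f)[1] ⟶ W ⟶ coker f`. If a class of objects cogenerates the heart, every object `M` of the
heart is the kernel of a morphism between objects of the class. When this class lies in
`T^{≤ k}`, so does `W`, and left compatibility puts the truncation `M[1]` of `W` in `T^{≤ k}` too:
`H_D ⊆ T^{≤ k + 1}`. Dévissage along `D`, starting from `D^{≤ -n} ⊆ T^{≤ k}`, gives
`D^{≤ -1} ⊆ T^{≤ k}`, whence `n ≤ 1` by minimality of the gap. Dually, cokernels and right
compatibility give `D^{≥ 0} ⊆ T^{≥ n + k - 1}`, i.e. `T^{≤ n + k - 1} ⊆ D^{≤ 0}`, whence `n ≤ 1`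
by maximality of the shift.

Conversely, `n ≤ 1` means `D^{≤ a - 1} ⊆ T^{≤ 0} ⊆ D^{≤ a}` with `a = -k`, so that every
truncation for `D` of an object of `T^{≤ 0}` either is an isomorphism or lands in `D^{≤ a - 1}`.
-/

namespace TStructurePair

open Pretriangulated AbelianSubcategory

section Generation

variable {A : Type u} [Category.{v} A]

lemma Cogenerates.mono {S S' : ObjectProperty A} (h : Cogenerates S) (hS : S ≤ S') :
    Cogenerates S' := fun M ↦
  let ⟨X, hX, hM⟩ := h M
  ⟨X, hS X hX, hM⟩

lemma Generates.mono {S S' : ObjectProperty A} (h : Generates S) (hS : S ≤ S') :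
    Generates S' := fun M ↦
  let ⟨X, hX, hM⟩ := h M
  ⟨X, hS X hX, hM⟩

variable [HasZeroMorphisms A]

lemma Cogenerates.exists_isLimit_kernelFork [IsNormalMonoCategory A] {S : ObjectProperty A}
    (h : Cogenerates S) (M : A) :
    ∃ (X X' : A) (f : X ⟶ X') (i : M ⟶ X) (w : i ≫ f = 0),
      S X ∧ S X' ∧ Nonempty (IsLimit (KernelFork.ofι i w)) := by
  obtain ⟨X, hX, i, _⟩ := h M
  let N := normalMonoOfMono i
  obtain ⟨X', hX', j, _⟩ := h N.Z
  exact ⟨X, X', N.g ≫ j, i, by simp [reassoc_of% N.w], hX, hX',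
    ⟨isKernelCompMono N.isLimit j rfl⟩⟩

lemma Generates.exists_isColimit_cokernelCofork [IsNormalEpiCategory A] {S : ObjectProperty A}
    (h : Generates S) (M : A) :
    ∃ (X X' : A) (f : X ⟶ X') (p : X' ⟶ M) (w : f ≫ p = 0),
      S X ∧ S X' ∧ Nonempty (IsColimit (CokernelCofork.ofπ p w)) := by
  obtain ⟨X', hX', p, _⟩ := h M
  let N := normalEpiOfEpi p
  obtain ⟨X, hX, q, _⟩ := h N.W
  exact ⟨X, X', q ≫ N.g, p, by simp [N.w], hX, hX', ⟨isCokernelEpiComp N.isColimit q rfl⟩⟩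

end Generation

variable {C : Type u} [Category.{v} C] [Preadditive C] [HasZeroObject C] [HasShift C ℤ]
  [∀ n : ℤ, (shiftFunctor C n).Additive] [Pretriangulated C]

section Truncation

variable (t : TStructure C)

lemma nonempty_triangleLTGE_iso {S : Triangle C} (hS : S ∈ distTriang C) (m : ℤ)
    (h₁ : t.IsLE S.obj₁ (m - 1)) (h₃ : t.IsGE S.obj₃ m) :
    Nonempty ((t.triangleLTGE m).obj S.obj₂ ≅ S) :=
  (t.triangle_iso_exists (t.triangleLTGE_distinguished m S.obj₂) hS (Iso.refl _) (m - 1) m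
    (t.isLE_truncLT_obj ..) (t.isGE_truncGE_obj ..) h₁ h₃).nonempty

lemma nonempty_triangleLTGE_shift_iso (X : C) (m a : ℤ) :
    Nonempty ((t.triangleLTGE m).obj (X⟦a⟧) ≅
      (Triangle.shiftFunctor C a).obj ((t.triangleLTGE (m + a)).obj X)) := by
  have : t.IsLE ((t.truncLT (m + a)).obj X) (m + a - 1) := t.isLE_truncLT_obj ..
  exact nonempty_triangleLTGE_iso t
    (Triangle.shift_distinguished _ (t.triangleLTGE_distinguished (m + a) X) a) m
    (t.isLE_shift _ (m + a - 1) a (m - 1))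
    (t.isGE_shift ((t.truncGE (m + a)).obj X) (m + a) a m)

end Truncation

section Heart

variable (t : TStructure C)

instance : t.heart.ContainsZero where
  exists_zero := by
    obtain ⟨Z, hZ⟩ := HasZeroObject.zero (C := C)
    exact ⟨Z, hZ, (t.mem_heart_iff Z).2 ⟨t.isLE_of_isZero hZ 0, t.isGE_of_isZero hZ 0⟩⟩

instance : t.heart.IsClosedUnderBinaryProducts where
  limitsOfShape_le := by
    rintro X ⟨p⟩
    obtain ⟨hl, hl'⟩ := (t.mem_heart_iff _).1 (p.prop_diag_obj (.mk .left))
    obtain ⟨hr, hr'⟩ := (t.mem_heart_iff _).1 (p.prop_diag_obj (.mk .right))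
    have hT := binaryProductTriangle_distinguished
      (p.diag.obj (.mk .left)) (p.diag.obj (.mk .right))
    exact t.heart.prop_of_iso
      (IsLimit.conePointUniqueUpToIso (prodIsProd _ _)
        ((IsLimit.postcomposeHomEquiv (diagramIsoPair p.diag) _).2 p.isLimit))
      ((t.mem_heart_iff _).2 ⟨t.isLE₂ _ hT 0 hl hr, t.isGE₂ _ hT 0 hl' hr'⟩)

instance : t.heart.IsClosedUnderFiniteProducts := .mk'

lemma heart_hom_shift_eq_zero ⦃X Y : t.heart.FullSubcategory⦄ ⦃n : ℤ⦄
    (f : t.heart.ι.obj X ⟶ (t.heart.ι.obj Y)⟦n⟧) (hn : n < 0) : f = 0 := by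
  have hX : t.IsLE X.obj 0 := ⟨X.property.1⟩
  have hY : t.IsGE Y.obj 0 := ⟨Y.property.2⟩
  exact t.zero_of_isLE_of_isGE f 0 (-n) (by lia) hX (t.isGE_shift Y.obj 0 n (-n))

variable {t} in
lemma isLE_and_isGE_of_distTriang_heart {X Y : t.heart.FullSubcategory} {f : X ⟶ Y} {W : C}
    {g : Y.obj ⟶ W} {h : W ⟶ X.obj⟦(1 : ℤ)⟧} (hT : Triangle.mk f.hom g h ∈ distTriang C) :
    t.IsLE W 0 ∧ t.IsGE W (-1) := by
  obtain ⟨hX, hX'⟩ := (t.mem_heart_iff _).1 X.property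
  obtain ⟨hY, hY'⟩ := (t.mem_heart_iff _).1 Y.property
  have hX₁ : t.IsLE (X.obj⟦(1 : ℤ)⟧) (-1) := t.isLE_shift _ 0 1 (-1)
  have hX₁' : t.IsGE (X.obj⟦(1 : ℤ)⟧) (-1) := t.isGE_shift _ 0 1 (-1)
  exact ⟨t.isLE₂ _ (rot_of_distTriang _ hT) 0 hY (t.isLE_of_le (X.obj⟦(1 : ℤ)⟧) (-1) 0),
    t.isGE₂ _ (rot_of_distTriang _ hT) (-1) (t.isGE_of_ge Y.obj (-1) 0) hX₁'⟩

variable [IsTriangulated C]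

lemma admissibleMorphism_heart_ι : admissibleMorphism t.heart.ι = ⊤ := by
  refine top_unique fun X Y f _ W g h hT ↦ ?_
  obtain ⟨_, _⟩ := isLE_and_isGE_of_distTriang_heart hT
  have : t.IsLE ((t.truncLT 0).obj W) (-1) := t.isLE_truncLT_obj ..
  let K : t.heart.FullSubcategory := ⟨((t.truncLT 0).obj W)⟦(-1 : ℤ)⟧, (t.mem_heart_iff _).2
    ⟨t.isLE_shift _ (-1) (-1) 0, t.isGE_shift _ (-1) (-1) 0⟩⟩
  let Q : t.heart.FullSubcategory := ⟨(t.truncGE 0).obj W, (t.mem_heart_iff _).2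
    ⟨inferInstance, inferInstance⟩⟩
  let e : K.obj⟦(1 : ℤ)⟧ ≅ (t.truncLT 0).obj W := (shiftEquiv C (1 : ℤ)).counitIso.app _
  refine ⟨K, Q, e.hom ≫ (t.truncLTι 0).app W, (t.truncGEπ 0).app W,
    (t.truncGEδLT 0).app W ≫ e.inv⟦(1 : ℤ)⟧',
    isomorphic_distinguished _ (t.triangleLTGE_distinguished 0 W) _
      (Triangle.isoMk _ _ e (Iso.refl _) (Iso.refl _) ?_ ?_ ?_)⟩
  · exact Category.comp_id _
  · exact (Category.comp_id _).trans (Category.id_comp _).symm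
  · exact (((shiftFunctor C (1 : ℤ)).mapIso e).comp_inv_eq.1 rfl).symm.trans
      (Category.id_comp _).symm

/-- The heart of a t-structure is abelian: its morphisms are admissible in the sense of
Beilinson, Bernstein, Deligne and Gabber. -/
noncomputable instance heartAbelian : Abelian t.heart.FullSubcategory :=
  abelian t.heart.ι (heart_hom_shift_eq_zero t) (admissibleMorphism_heart_ι t)

variable {t}

lemma nonempty_truncLT_iso_of_isLimit_kernelFork {M X X' : t.heart.FullSubcategory} {f : X ⟶ X'}
    {i : M ⟶ X} {w : i ≫ f = 0} (hi : IsLimit (KernelFork.ofι i w)) {W : C} {g : X'.obj ⟶ W}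
    {h : W ⟶ X.obj⟦(1 : ℤ)⟧} (hT : Triangle.mk f.hom g h ∈ distTriang C) :
    Nonempty ((t.truncLT 0).obj W ≅ M.obj⟦(1 : ℤ)⟧) := by
  have hf : admissibleMorphism t.heart.ι f := by simp [admissibleMorphism_heart_ι]
  obtain ⟨K, Q, α, β, γ, hT'⟩ := hf g h hT
  have hK : t.IsLE K.obj 0 := ⟨K.property.1⟩
  obtain ⟨e⟩ := nonempty_triangleLTGE_iso t hT' 0 (t.isLE_shift K.obj 0 1 (0 - 1)) ⟨Q.property.2⟩
  exact ⟨Triangle.π₁.mapIso e ≪≫ (t.heart.ι ⋙ shiftFunctor C (1 : ℤ)).mapIso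
    ((isLimitKernelFork (heart_hom_shift_eq_zero t) hT hT').conePointUniqueUpToIso hi)⟩

lemma nonempty_truncGE_iso_of_isColimit_cokernelCofork {X X' M : t.heart.FullSubcategory}
    {f : X ⟶ X'} {p : X' ⟶ M} {w : f ≫ p = 0} (hp : IsColimit (CokernelCofork.ofπ p w)) {W : C}
    {g : X'.obj ⟶ W} {h : W ⟶ X.obj⟦(1 : ℤ)⟧} (hT : Triangle.mk f.hom g h ∈ distTriang C) :
    Nonempty ((t.truncGE 0).obj W ≅ M.obj) := by
  have hf : admissibleMorphism t.heart.ι f := by simp [admissibleMorphism_heart_ι]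
  obtain ⟨K, Q, α, β, γ, hT'⟩ := hf g h hT
  have hK : t.IsLE K.obj 0 := ⟨K.property.1⟩
  obtain ⟨e⟩ := nonempty_triangleLTGE_iso t hT' 0 (t.isLE_shift K.obj 0 1 (0 - 1)) ⟨Q.property.2⟩
  exact ⟨Triangle.π₃.mapIso e ≪≫ t.heart.ι.mapIso
    ((isColimitCokernelCofork (heart_hom_shift_eq_zero t) hT hT').coconePointUniqueUpToIso hp)⟩

end Heart

section Aisles

lemma heart_shift_le (t : TStructure C) (a : ℤ) : t.heart.shift a ≤ t.le a ⊓ t.ge a := by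
  intro X hX
  have hX₁ : t.IsLE (X⟦a⟧) 0 := ⟨hX.1⟩
  have hX₂ : t.IsGE (X⟦a⟧) 0 := ⟨hX.2⟩
  exact ⟨(t.isLE_of_shift X a a 0).le, (t.isGE_of_shift X a a 0).ge⟩

variable {S R : TStructure C} {a b c d : ℤ}

lemma le_le_iff_ge_le (h : a + d = b + c) : S.le a ≤ R.le b ↔ R.ge d ≤ S.ge c := by
  constructor
  · intro hle X hX
    have hX' : R.IsGE (X⟦c - a - 1⟧) (b + 1) :=
      ⟨R.ge_shift d (c - a - 1) (b + 1) (by lia) X hX⟩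
    have : S.IsGE (X⟦c - a - 1⟧) (a + 1) := (S.isGE_iff_orthogonal a _ rfl _).2 fun Y f hY ↦
      R.zero_of_isLE_of_isGE f b (b + 1) (by lia) ⟨hle _ hY.le⟩ hX'
    exact (S.isGE_of_shift X c (c - a - 1) (a + 1)).ge
  · intro hge X hX
    have hX' : S.IsLE (X⟦a - c + 1⟧) (c - 1) :=
      ⟨S.le_shift a (a - c + 1) (c - 1) (by lia) X hX⟩
    have : R.IsLE (X⟦a - c + 1⟧) (d - 1) := (R.isLE_iff_orthogonal _ d (by lia) _).2 fun Y f hY ↦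
      S.zero_of_isLE_of_isGE f (c - 1) c (by lia) hX' ⟨hge _ hY.ge⟩
    exact (R.isLE_of_shift X b (a - c + 1) (d - 1)).le

lemma le_le_iff_le_le (h : a + d = b + c) : S.le a ≤ R.le b ↔ S.le c ≤ R.le d :=
  (le_le_iff_ge_le (c := a) (d := b) (by lia)).trans (le_le_iff_ge_le (by lia)).symm

end Aisles

variable {D T : TStructure C} {n : ℕ} {a b c k : ℤ}

section Devissage

lemma isLE_of_heart_le (h : D.heart ≤ T.le c) (X : C) (j : ℤ) [D.IsLE X j] [D.IsGE X j] :
    T.IsLE X (c + j) := by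
  have : T.IsLE (X⟦j⟧) c :=
    ⟨h _ ((D.mem_heart_iff _).2 ⟨D.isLE_shift X j j 0, D.isGE_shift X j j 0⟩)⟩
  exact T.isLE_of_shift X (c + j) j c

lemma isGE_of_heart_le (h : D.heart ≤ T.ge c) (X : C) (j : ℤ) [D.IsLE X j] [D.IsGE X j] :
    T.IsGE X (c + j) := by
  have : T.IsGE (X⟦j⟧) c :=
    ⟨h _ ((D.mem_heart_iff _).2 ⟨D.isLE_shift X j j 0, D.isGE_shift X j j 0⟩)⟩
  exact T.isGE_of_shift X (c + j) j c

variable [IsTriangulated C]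

lemma le_sub_le_of_heart_le (h : D.heart ≤ T.le c) (hab : D.le a ≤ T.le b) :
    D.le (b - c) ≤ T.le b := by
  suffices ∀ j, a ≤ j → j ≤ b - c → D.le j ≤ T.le b by
    rcases le_total a (b - c) with hac | hca
    · exact this _ hac le_rfl
    · exact (D.le_monotone hca).trans hab
  intro j haj
  induction j, haj using Int.leInduction with
  | base => exact fun _ ↦ hab
  | succ j _ ih =>
    intro hj X hX
    have : D.IsLE X (j + 1) := ⟨hX⟩
    have hlt : D.IsLE ((D.truncLT (j + 1)).obj X) j := D.isLE_truncLT_obj ..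
    have : T.IsLE ((D.truncGE (j + 1)).obj X) (c + (j + 1)) := isLE_of_heart_le h _ _
    exact (T.isLE₂ _ (D.triangleLTGE_distinguished (j + 1) X) b ⟨ih (by lia) _ hlt.le⟩
      (T.isLE_of_le ((D.truncGE (j + 1)).obj X) (c + (j + 1)) b)).le

lemma ge_sub_le_of_heart_le (h : D.heart ≤ T.ge c) (hab : D.ge a ≤ T.ge b) :
    D.ge (b - c) ≤ T.ge b := by
  suffices ∀ j, j ≤ a → b - c ≤ j → D.ge j ≤ T.ge b by
    rcases le_total (b - c) a with hca | hac
    · exact this _ hca le_rfl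
    · exact (D.ge_antitone hac).trans hab
  intro j hja
  induction j, hja using Int.leInductionDown with
  | base => exact fun _ ↦ hab
  | pred j _ ih =>
    intro hj X hX
    have : D.IsGE X (j - 1) := ⟨hX⟩
    have : D.IsLE ((D.truncLT j).obj X) (j - 1) := D.isLE_truncLT_obj ..
    have : T.IsGE ((D.truncLT j).obj X) (c + (j - 1)) := isGE_of_heart_le h _ _
    have hge : D.IsGE ((D.truncGE j).obj X) j := inferInstance
    exact (T.isGE₂ _ (D.triangleLTGE_distinguished j X) b
      (T.isGE_of_ge ((D.truncLT j).obj X) b (c + (j - 1))) ⟨ih (by lia) _ hge.ge⟩).ge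

end Devissage

section Compatible

lemma isLeftCompatible_of_le (h : T.le 0 ≤ D.le a) (h' : D.le (a - 1) ≤ T.le 0) :
    IsLeftCompatible D T := by
  intro m X hX
  rcases le_or_gt a m with ham | hma
  · have : IsIso ((D.truncLTι (m + 1)).app X) :=
      (D.isLE_iff_isIso_truncLTι_app m (m + 1) rfl X).1 ⟨D.le_monotone ham _ (h _ hX)⟩
    exact (T.le 0).prop_of_iso (asIso ((D.truncLTι (m + 1)).app X)).symm hX
  · have : D.IsLE ((D.truncLE m).obj X) (a - 1) := D.isLE_truncLT_obj _ _ _ (by lia)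
    exact h' _ this.le

lemma isRightCompatible_of_ge (h : T.ge 0 ≤ D.ge (a - 1)) (h' : D.ge a ≤ T.ge 0) :
    IsRightCompatible D T := by
  intro m X hX
  rcases lt_or_ge m a with hma | ham
  · have : IsIso ((D.truncGEπ m).app X) :=
      (D.isGE_iff_isIso_truncGEπ_app m X).1 ⟨D.ge_antitone (by lia) _ (h _ hX)⟩
    exact (T.ge 0).prop_of_iso (asIso ((D.truncGEπ m).app X)) hX
  · have : D.IsGE ((D.truncGE m).obj X) a := D.isGE_of_ge _ a m
    exact h' _ this.ge

lemma IsOfType.le_neg_one_le (h : IsOfType D T n k) (hn : n ≤ 1) : D.le (-1) ≤ T.le k :=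
  (D.le_monotone (by lia)).trans h.gap.1

lemma IsOfType.isLeftCompatible (h : IsOfType D T n k) (hn : n ≤ 1) : IsLeftCompatible D T :=
  isLeftCompatible_of_le (a := -k) ((le_le_iff_le_le (by lia)).1 h.shift.1)
    ((le_le_iff_le_le (by lia)).1 (h.le_neg_one_le hn))

lemma IsOfType.isRightCompatible (h : IsOfType D T n k) (hn : n ≤ 1) : IsRightCompatible D T :=
  isRightCompatible_of_ge (a := -k) ((le_le_iff_ge_le (by lia)).1 (h.le_neg_one_le hn))
    ((le_le_iff_ge_le (by lia)).1 h.shift.1)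

lemma IsLeftCompatible.isLE_truncLT_obj (h : IsLeftCompatible D T) (m a : ℤ) (X : C)
    [T.IsLE X a] : T.IsLE ((D.truncLT m).obj X) a := by
  obtain ⟨e⟩ := nonempty_triangleLTGE_shift_iso D X (m - a) a
  have hX : T.IsLE (X⟦a⟧) 0 := T.isLE_shift X a a 0
  have hlt : T.IsLE ((D.truncLT (m - a)).obj (X⟦a⟧)) 0 :=
    ⟨by simpa [TStructure.truncLE] using h (m - a - 1) _ hX.le⟩
  have : T.IsLE (((D.truncLT (m - a + a)).obj X)⟦a⟧) 0 :=
    ⟨(T.le 0).prop_of_iso (Triangle.π₁.mapIso e) hlt.le⟩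
  simpa using T.isLE_of_shift ((D.truncLT (m - a + a)).obj X) a a 0

lemma IsRightCompatible.isGE_truncGE_obj (h : IsRightCompatible D T) (m a : ℤ) (X : C)
    [T.IsGE X a] : T.IsGE ((D.truncGE m).obj X) a := by
  obtain ⟨e⟩ := nonempty_triangleLTGE_shift_iso D X (m - a) a
  have hX : T.IsGE (X⟦a⟧) 0 := T.isGE_shift X a a 0
  have hge : T.IsGE ((D.truncGE (m - a)).obj (X⟦a⟧)) 0 := ⟨h _ _ hX.ge⟩
  have : T.IsGE (((D.truncGE (m - a + a)).obj X)⟦a⟧) 0 :=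
    ⟨(T.ge 0).prop_of_iso (Triangle.π₃.mapIso e) hge.ge⟩
  simpa using T.isGE_of_shift ((D.truncGE (m - a + a)).obj X) a a 0

variable [IsTriangulated C]

lemma IsLeftCompatible.heart_le (h : IsLeftCompatible D T)
    (hc : Cogenerates ((T.le k).inverseImage D.heart.ι)) : D.heart ≤ T.le (k + 1) := by
  intro M hM
  obtain ⟨X, X', f, i, w, hX, hX', ⟨hi⟩⟩ := hc.exists_isLimit_kernelFork ⟨M, hM⟩
  obtain ⟨W, g, δ, hT⟩ := distinguished_cocone_triangle f.hom
  obtain ⟨e⟩ := nonempty_truncLT_iso_of_isLimit_kernelFork hi hT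
  have hX₁ : T.IsLE (X.obj⟦(1 : ℤ)⟧) k := ⟨T.le_monotone (by lia) _
    (T.le_shift k 1 (k - 1) (by lia) _ hX)⟩
  have hW : T.IsLE W k := T.isLE₂ _ (rot_of_distTriang _ hT) k ⟨hX'⟩ hX₁
  have := h.isLE_truncLT_obj 0 k W
  have hM₁ : T.IsLE (M⟦(1 : ℤ)⟧) k := T.isLE_of_iso e k
  exact (T.isLE_of_shift M (k + 1) 1 k).le

lemma IsRightCompatible.heart_le (h : IsRightCompatible D T)
    (hg : Generates ((T.ge k).inverseImage D.heart.ι)) : D.heart ≤ T.ge (k - 1) := by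
  intro M hM
  obtain ⟨X, X', f, p, w, hX, hX', ⟨hp⟩⟩ := hg.exists_isColimit_cokernelCofork ⟨M, hM⟩
  obtain ⟨W, g, δ, hT⟩ := distinguished_cocone_triangle f.hom
  obtain ⟨e⟩ := nonempty_truncGE_iso_of_isColimit_cokernelCofork hp hT
  have hX₁' : T.IsGE X'.obj (k - 1) := ⟨T.ge_antitone (by lia) _ hX'⟩
  have hX₁ : T.IsGE (X.obj⟦(1 : ℤ)⟧) (k - 1) := ⟨T.ge_shift k 1 (k - 1) (by lia) _ hX⟩
  have hW : T.IsGE W (k - 1) := T.isGE₂ _ (rot_of_distTriang _ hT) (k - 1) hX₁' hX₁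
  have := h.isGE_truncGE_obj 0 (k - 1) W
  exact (T.isGE_of_iso e (k - 1)).ge

lemma IsOfType.le_one_of_isLeftCompatible (h : IsOfType D T n k)
    (hc : Cogenerates ((T.le k).inverseImage D.heart.ι)) (hT : IsLeftCompatible D T) :
    n ≤ 1 := by
  have hgap := le_sub_le_of_heart_le (hT.heart_le hc) h.gap.1
  exact h.gap.2 (by simpa using hgap)

lemma IsOfType.le_one_of_isRightCompatible (h : IsOfType D T n k)
    (hg : Generates ((T.ge (n + k)).inverseImage D.heart.ι)) (hT : IsRightCompatible D T) :
    n ≤ 1 := by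
  have hshift : D.ge n ≤ T.ge (n + k - 1) :=
    ((le_le_iff_ge_le (by lia)).1 h.shift.1).trans (T.ge_antitone (by lia : n + k - 1 ≤ n + k))
  have hge : D.ge 0 ≤ T.ge (n + k - 1) := by
    simpa using ge_sub_le_of_heart_le (hT.heart_le hg) hshift
  have hle : n + k - 1 ≤ k := h.shift.2 ((le_le_iff_ge_le (by lia)).2 hge)
  lia

end Compatible

end TStructurePair

theorem mainTheorem6_general {C : Type u} [Category.{v} C] [Preadditive C] [HasZeroObject C]
    [HasShift C ℤ] [∀ n : ℤ, (shiftFunctor C n).Additive] [Pretriangulated C]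
    [IsTriangulated C] {D T : TStructure C} {n : ℕ} {k : ℤ}
    (h : TStructurePair.IsOfType D T n k) :
    (TStructurePair.Cogenerates ((T.heart.shift k).inverseImage D.heart.ι) →
      (TStructurePair.IsLeftCompatible D T ↔ n = 0 ∨ n = 1)) ∧
    (TStructurePair.Generates ((T.heart.shift (n + k)).inverseImage D.heart.ι) →
      (TStructurePair.IsRightCompatible D T ↔ n = 0 ∨ n = 1)) ∧
    (n = 0 ∨ n = 1 → TStructurePair.IsLeftCompatible D T) := by
  rw [← Nat.le_one_iff_eq_zero_or_eq_one]
  refine ⟨fun hc ↦ ⟨h.le_one_of_isLeftCompatible ?_, h.isLeftCompatible⟩,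
    fun hg ↦ ⟨h.le_one_of_isRightCompatible ?_, h.isRightCompatible⟩, h.isLeftCompatible⟩
  · exact hc.mono fun X hX ↦ (TStructurePair.heart_shift_le T k _ hX).1
  · exact hg.mono fun X hX ↦ (TStructurePair.heart_shift_le T (n + k) _ hX).2

theorem mainTheorem6 {C : Type u} [Category.{v} C] [Preadditive C] [HasZeroObject C]
    [HasShift C ℤ] [∀ n : ℤ, (shiftFunctor C n).Additive] [Pretriangulated C]
    [IsTriangulated C] (D T : TStructure C) (n : ℕ) :
    (TStructurePair.IsTilting D T n →
      (TStructurePair.IsLeftCompatible D T ↔ n = 0 ∨ n = 1)) ∧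
    (TStructurePair.IsCotilting D T n →
      (TStructurePair.IsRightCompatible D T ↔ n = 0 ∨ n = 1) ∧
      (n = 0 ∨ n = 1 → TStructurePair.IsLeftCompatible D T)) :=
  ⟨fun h ↦ (mainTheorem6_general h.ofType).1 (by simpa using h.cogenerates),
    fun h ↦ (mainTheorem6_general h.ofType).2.imp_left fun H ↦ H (by simpa using h.generates)⟩
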